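/- Let $n\ge 1$, let $\alpha=(\alpha_1,\dots,\alpha_n)$ be a weak composition (a sequence of non-negative integers) and let $\sigma\in S_n$, written $(\sigma_1,\dots,\sigma_n)$ in one-line notation. The augmented diagram of shape $\alpha$ has rows $1,\dots,n$ from top to bottom, row $r$ consisting of the boxes $(r,c)$ with $0\le c\le \alpha_r$; column $0$ is called the basement. An (augmented) filling $F$ of shape $\alpha$ and basement $\sigma$ assigns to each box an entry in $\{1,\dots,n\}$, with $F(r,0)=\sigma_r$. A type $A$ triple consists of boxes $a=(r,c)$, $b=(r,c+1)$, $c'=(r',c+1)$ of the diagram with $r'>r$ (so $c'$ is below $b$) and $\alpha_{r'}\le\alpha_r$; it is an inversion triple if its entries, read in increasing order, run counter-clockwise. A type $B$ triple consists of boxes $a=(r,c)$, $b=(r,c+1)$, $c'=(r',c)$ of the diagram with $r'<r$ (so $c'$ is above $a$) and $\alpha_{r'}<\alpha_r$; it is an inversion triple if its entries, read in increasing order, run clockwise. In both cases equal entries are ordered by the rule that $b$ counts as smaller than $c'$ and $c'$ as smaller than $a$. A triple that is not an inversion triple is a coinversion triple, and $\mathrm{CoInvFree}(\alpha,\sigma)$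 denotes the set of fillings of shape $\alpha$ and basement $\sigma$ without coinversion triples. The major index is $\mathrm{maj}(F)=\sum(\alpha_r-c+1)$, the sum being over all boxes $(r,c)$ with $c\ge 1$ and $F(r,c-1)<F(r,c)$. The column sets of $F$ are the multisets of entries of its columns, listed from left to right. Let $s_i$ act on $\alpha$ and on $\sigma$ by interchanging the entries in positions $i$ and $i+1$. **Proposition.** Let $1\le i<n$, $\sigma_i>\sigma_{i+1}$ and $\alpha_i>\alpha_{i+1}$. Then there is an injection $$\varphi:\mathrm{CoInvFree}(\alpha,\sigma)\hookrightarrow \mathrm{CoInvFree}(s_i\alpha,\sigma)\sqcup\mathrm{CoInvFree}(s_i\alpha,s_i\sigma)$$ that preserves column sets and the major index, and $\varphi$ is a bijection whenever $\sigma_i=\sigma_{i+1}+1$. Explicitly, $F'=\varphi(F)$ agrees with $F$ in all rows other than $i$ and $i+1$; for $\alpha_{i+1}<c\le\alpha_i$ one has $F'(i+1,c)=F(i,c)$; and for $c=\alpha_{i+1},\alpha_{i+1}-1,\dots,0$ successively, with $C=F'(i+1,c+1)$, the two entries $F(i,c)$ and $F(i+1,c)$ are placed in the boxes $(i,c)$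 and $(i+1,c)$ of $F'$ so that the box $(i+1,c)$ receives the least of them that is at least $C$ if there is one, and the smaller of the two otherwise. -/

import Mathlib

namespace ColSet

/-- Augmented fillings of shape `α` (a weak composition with `n` parts) and basement `σ`, with
entries in `{1, …, n}`. Rows are indexed from top to bottom by `Fin n`; row `r` consists of the
boxes `(r, c)` with `0 ≤ c ≤ α r`, and column `0` is the basement. The basement entry of row `r`
is `σ r + 1`, the value of the permutation in one-line notation. As only the boxes of the diagram
carry entries, the function `entry` is normalised to `0` outside the diagram. -/
@[ext]
structure Filling {n : ℕ} (α : Fin n → ℕ) (σ : Equiv.Perm (Fin n)) where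
  entry : Fin n → ℕ → ℕ
  basement : ∀ r, entry r 0 = (σ r : ℕ) + 1
  entry_mem : ∀ r c, c ≤ α r → entry r c ∈ Set.Icc 1 n
  entry_outside : ∀ r c, α r < c → entry r c = 0

/-- The order on pairs (entry, subscript) used to order the three entries of a triple: by entry,
and among equal entries the one with the largest subscript is the largest. -/
def SubLT (x y : ℕ × ℕ) : Prop := x.1 < y.1 ∨ (x.1 = y.1 ∧ x.2 < y.2)

/-- Going around `x → y → z → x`, one meets the three entries in increasing order, starting from
the smallest one. -/
def CyclicInc (x y z : ℕ × ℕ) : Prop :=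
  (SubLT x y ∧ SubLT y z) ∨ (SubLT y z ∧ SubLT z x) ∨ (SubLT z x ∧ SubLT x y)

/-- Type `A`: `a` is immediately to the left of `b` and `c` is below `b`. The closed path
`a → c → b → a` is counter-clockwise. The subscripts are `a₃`, `b₁`, `c₂`. -/
def InversionA (a b c : ℕ) : Prop := CyclicInc (a, 3) (c, 2) (b, 1)

/-- Type `B`: `a` is immediately to the left of `b` and `c` is above `a`. The closed path
`c → b → a → c` is clockwise. The subscripts are `a₃`, `b₁`, `c₂`. -/
def InversionB (a b c : ℕ) : Prop := CyclicInc (c, 2) (b, 1) (a, 3)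

namespace Filling

variable {n : ℕ} {α : Fin n → ℕ} {σ : Equiv.Perm (Fin n)}

/-- No triple of type `A` or `B` is a coinversion triple. Type `A` triples consist of the boxes
`a = (r, c)`, `b = (r, c + 1)` and `(r', c + 1)` with row `r'` below row `r` and `α r' ≤ α r`;
type `B` triples of the boxes `a = (r, c)`, `b = (r, c + 1)` and `(r', c)` with row `r'` above
row `r` and `α r' < α r`. Basement boxes are included. -/
def IsCoinvFree (F : Filling α σ) : Prop :=
  (∀ (r r' : Fin n) (c : ℕ), r < r' → α r' ≤ α r → c + 1 ≤ α r → c + 1 ≤ α r' →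
      InversionA (F.entry r c) (F.entry r (c + 1)) (F.entry r' (c + 1))) ∧
  (∀ (r r' : Fin n) (c : ℕ), r' < r → α r' < α r → c + 1 ≤ α r → c ≤ α r' →
      InversionB (F.entry r c) (F.entry r (c + 1)) (F.entry r' c))

/-- The number of boxes to the right of the box `(r, c)` in the diagram of `α`. -/
def leg (α : Fin n → ℕ) (r : Fin n) (c : ℕ) : ℕ := α r - c

/-- The major index: the sum of `leg u + 1` over all descents `u`, that is, over the non-basement
boxes `u = (r, c)`, `1 ≤ c ≤ α r`, whose entry is larger than the entry immediately to the left. -/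
def maj (F : Filling α σ) : ℕ :=
  ∑ r : Fin n, ∑ c ∈ Finset.Icc 1 (α r),
    if F.entry r (c - 1) < F.entry r c then leg α r c + 1 else 0

/-- The multiset of entries in column `c`. -/
def columnSet (F : Filling α σ) (c : ℕ) : Multiset ℕ :=
  (Finset.univ.filter fun r : Fin n => c ≤ α r).val.map fun r => F.entry r c

end Filling

/-- The set of coinversion-free fillings of shape `α` and basement `σ`, as a type. -/
def CoInvFree {n : ℕ} (α : Fin n → ℕ) (σ : Equiv.Perm (Fin n)) : Type :=
  {F : Filling α σ // F.IsCoinvFree}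

/-- `α` with the parts in rows `i` and `j` interchanged. -/
def swapShape {n : ℕ} (i j : Fin n) (α : Fin n → ℕ) : Fin n → ℕ :=
  fun r => α (Equiv.swap i j r)

/-- `σ` with the entries in positions `i` and `j` of its one-line notation interchanged. -/
def swapBasement {n : ℕ} (i j : Fin n) (σ : Equiv.Perm (Fin n)) : Equiv.Perm (Fin n) :=
  σ * Equiv.swap i j

/-- The disjoint union of the coinversion-free fillings of shape `sᵢ α` with basement `σ` and of
those with basement `sᵢ σ`, where `j` is the row below row `i`. -/
abbrev Target {n : ℕ} (α : Fin n → ℕ) (σ : Equiv.Perm (Fin n)) (i j : Fin n) : Type :=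
  CoInvFree (swapShape i j α) σ ⊕ CoInvFree (swapShape i j α) (swapBasement i j σ)

namespace Target

variable {n : ℕ} {α : Fin n → ℕ} {σ : Equiv.Perm (Fin n)} {i j : Fin n}

def entry (G : Target α σ i j) : Fin n → ℕ → ℕ :=
  Sum.elim (fun H => H.1.entry) (fun H => H.1.entry) G

def maj (G : Target α σ i j) : ℕ :=
  Sum.elim (fun H => H.1.maj) (fun H => H.1.maj) G

def columnSet (G : Target α σ i j) (c : ℕ) : Multiset ℕ :=
  Sum.elim (fun H => H.1.columnSet c) (fun H => H.1.columnSet c) G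

end Target

/-- The entry among `A`, `B` that is put in the bottom row, to the left of `C`: the least of `A`,
`B` that is at least `C` if there is one, and otherwise the smaller of `A`, `B`. -/
def bottomChoice (A B C : ℕ) : ℕ :=
  if C ≤ min A B then min A B else if C ≤ max A B then max A B else min A B

/-- The entries `F'` are obtained from the entries `F` (of a filling of shape `α`) by applying the
filling rule to the rows `i` and `j`, where `j` is the row below row `i` and `α j < α i`:
all other rows are unchanged; an entry of row `i` in a column beyond the end of row `j` moves down
to row `j`; and the remaining columns are processed from right to left, the two entries
`F i c`, `F j c` being redistributed so that `bottomChoice` is in row `j` and the other one in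
row `i`. -/
def FillingRule {n : ℕ} (α : Fin n → ℕ) (i j : Fin n) (F F' : Fin n → ℕ → ℕ) : Prop :=
  (∀ r, r ≠ i → r ≠ j → F' r = F r) ∧
  (∀ c, α j < c → c ≤ α i → F' j c = F i c) ∧
  (∀ c, c ≤ α j →
    F' j c = bottomChoice (F i c) (F j c) (F' j (c + 1)) ∧
    ({F' i c, F' j c} : Multiset ℕ) = {F i c, F j c})

end ColSet

/-!
Types `A` and `B` impose the same condition on the entries `a`, `b`, `c` of a triple: going upwards
from `b` around the cyclic order of the entries, one reaches `a` without passing through `c`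
(`CycAvoids`). Only the shape of the triples differs, so the statement is about pairs of rows.

Write `f`, `g` for the rows `i`, `j` of `F`, of lengths `M > m`, and `f'`, `g'` for the rows `i`, `j`
of `F'`, of lengths `m < M`. The filling rule says that `f'`, `g'` arise from `f`, `g` by
interchanging the two entries in some columns, including all columns beyond `m`, in such a way that
the type `B` triples of `f'`, `g'` are inversion triples; this determines `g'` from right to left.
Conversely the type `A` triples of `f`, `g` determine `f` from left to right, starting with the
basement entry `σ i`. So both maps are forced by the column sets (`RowExchange.left_unique`,
`RowExchange.right_unique`), and it remains to compare the triples that involve a third row `x`.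

If `x` is longer than both rows or shorter than both, it forms triples of the same type with them,
and the conditions are seen to be equivalent one pair of columns at a time. If its length lies
between `m` and `M`, the equivalence is not local. What carries it along the rows is an invariant:
in each column `c ≤ m` in which the entries were left in place, `g c`, `f c`, `x c` are in
increasing cyclic order. Before the exchange the invariant follows from right to left, with nothing
to check at the start (`RowExchange.cycLT_above`, `RowExchange.cycLT_below`); after it, from left to
right, provided that it holds in the basement (`RowExchange.cycLT_above'`,
`RowExchange.cycLT_below'`), which is the case if `σ i = σ j + 1`. So the image
of `F` is coinversion-free in general, and for consecutive values every element is an image.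

For the major index, a row of length `k` contributes the sum over `d ≤ k` of its number of descents
in the columns `1, …, d`. Up to column `m` the two rows together have equally many descents before
and after the exchange; and up to column `m + 1` so do the two long rows, because `σ j < σ i`
(`RowExchange.desCount_tail`).
-/

namespace ColSet

/-! ### Cyclic intervals -/

/-- `c` does not lie on the cyclic interval that starts at `b` and runs upwards, past the largest
entry to the smallest one if necessary, until it ends at `a`. -/
def CycAvoids (a b c : ℕ) : Prop := (a < c ∧ c < b) ∨ (c < b ∧ b ≤ a) ∨ (b ≤ a ∧ a < c)

/-- `a`, `b`, `c` are distinct and are met in this order when going upwards cyclically. -/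
def CycLT (a b c : ℕ) : Prop := (a < b ∧ b < c) ∨ (b < c ∧ c < a) ∨ (c < a ∧ a < b)

lemma inversionA_iff {a b c : ℕ} : InversionA a b c ↔ CycAvoids a b c := by
  simp only [InversionA, CyclicInc, SubLT, CycAvoids]; omega

lemma inversionB_iff {a b c : ℕ} : InversionB a b c ↔ CycAvoids a b c := by
  simp only [InversionB, CyclicInc, SubLT, CycAvoids]; omega

lemma CycAvoids.ne {a b c : ℕ} (h : CycAvoids a b c) : a ≠ c := by
  unfold CycAvoids at h; omega

lemma CycAvoids.ne' {a b c : ℕ} (h : CycAvoids a b c) : b ≠ c := by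
  unfold CycAvoids at h; omega

/-- `bottomChoice` picks the one of two distinct entries that is met first when going upwards
from `C`. -/
lemma cycAvoids_bottomChoice {p q C b : ℕ} (hpq : p ≠ q) (hb : b = bottomChoice p q C) :
    (b = p ∧ CycAvoids b C q) ∨ (b = q ∧ CycAvoids b C p) := by
  unfold bottomChoice at hb
  unfold CycAvoids
  split_ifs at hb <;> omega

lemma eq_bottomChoice {a b C : ℕ} (h : CycAvoids a C b) :
    a = bottomChoice a b C ∧ a = bottomChoice b a C := by
  unfold CycAvoids at h
  unfold bottomChoice
  constructor <;> split_ifs <;> omega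

/-- The rule dual to `bottomChoice`: the greatest of `A`, `B` that is at most `C` if there is one,
and otherwise the greater of `A`, `B`. -/
def topChoice (A B C : ℕ) : ℕ :=
  if max A B ≤ C then max A B else if min A B ≤ C then min A B else max A B

/-- `topChoice` picks the one of two distinct entries that is met first when going downwards
from `C`. -/
lemma cycAvoids_topChoice {p q C b : ℕ} (hpq : p ≠ q) (hb : b = topChoice p q C) :
    (b = p ∧ CycAvoids C b q) ∨ (b = q ∧ CycAvoids C b p) := by
  unfold topChoice at hb
  unfold CycAvoids
  split_ifs at hb <;> omega

/-- At most one of two entries is met first when going upwards from `C`. -/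
lemma CycAvoids.asymm_left {a b C : ℕ} (h : CycAvoids a C b) : ¬ CycAvoids b C a := by
  unfold CycAvoids at *; omega

lemma CycAvoids.asymm_right {a b C : ℕ} (h : CycAvoids C a b) : ¬ CycAvoids C b a := by
  unfold CycAvoids at *; omega

/-! ### Pairs of rows -/

/-- There are no coinversion triples in a pair of rows, of which the upper one has length `a` and
entries `x`, and the lower one has length `b` and entries `y`. -/
def PairFree (a b : ℕ) (x y : ℕ → ℕ) : Prop :=
  (b ≤ a → ∀ c, c + 1 ≤ b → CycAvoids (x c) (x (c + 1)) (y (c + 1))) ∧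
  (a < b → ∀ c, c ≤ a → CycAvoids (y c) (y (c + 1)) (x c))

/-- The upper row `f` and the lower row `g`, of lengths `M > m`, are turned into the upper row `f'`
and the lower row `g'`, of lengths `m < M`, by interchanging the two entries in some of the columns,
including all columns beyond `m`; neither pair of rows has coinversion triples. -/
structure RowExchange (m M : ℕ) (f g f' g' : ℕ → ℕ) : Prop where
  lt : m < M
  or : ∀ c, (f' c = f c ∧ g' c = g c) ∨ (f' c = g c ∧ g' c = f c)
  right : ∀ c, m < c → f' c = g c ∧ g' c = f c
  pair : PairFree M m f g
  pair' : PairFree m M f' g'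

namespace RowExchange

variable {m M k : ℕ} {f g f' g' x : ℕ → ℕ}

lemma avoids (h : RowExchange m M f g f' g') {c : ℕ} (hc : c + 1 ≤ m) :
    CycAvoids (f c) (f (c + 1)) (g (c + 1)) := h.pair.1 h.lt.le c hc

lemma avoids' (h : RowExchange m M f g f' g') {c : ℕ} (hc : c ≤ m) :
    CycAvoids (g' c) (g' (c + 1)) (f' c) := h.pair'.2 h.lt c hc

lemma eq_of_eq (h : RowExchange m M f g f' g') {c : ℕ} (hg : g' c = g c) : f' c = f c := by
  rcases h.or c with ⟨e1, e2⟩ | ⟨e1, e2⟩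
  · exact e1
  · rw [e1, ← hg, e2]

/-- A row that forms triples of the same type with both rows: the two conditions on one pair of
columns hold before the exchange if and only if they hold after it. -/
lemma avoids_both_iff (h : RowExchange m M f g f' g') {c : ℕ} (hc : c + 1 ≤ m) (y : ℕ) :
    CycAvoids (f c) (f (c + 1)) y ∧ CycAvoids (g c) (g (c + 1)) y ↔
      CycAvoids (f' c) (f' (c + 1)) y ∧ CycAvoids (g' c) (g' (c + 1)) y := by
  have h1 := h.avoids hc
  have h2 := h.avoids' (c := c) (by omega)
  rcases h.or c with ⟨e1, e2⟩ | ⟨e1, e2⟩ <;> rcases h.or (c + 1) with ⟨e3, e4⟩ | ⟨e3, e4⟩ <;>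
    rw [e1, e2, e4] at h2 <;> rw [e1, e2, e3, e4]
  · unfold CycAvoids at *; omega
  · unfold CycAvoids at *; omega
  · exact and_comm

/-! ### Rows of intermediate length -/

/-- Let a row `x` above be at least as long as the shorter row and shorter than the longer one.
In each column in which the exchange leaves the entries in place, the lower entry, the upper one
and that of `x` are in increasing cyclic order. -/
lemma cycLT_above (h : RowExchange m M f g f' g')
    (hA : ∀ c, c + 1 ≤ m → CycAvoids (x c) (x (c + 1)) (g (c + 1)))
    (hB : ∀ c, c ≤ m → CycAvoids (f c) (f (c + 1)) (x c)) {c : ℕ} (hc : c ≤ m)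
    (hg : g' c = g c) : CycLT (g c) (f c) (x c) := by
  induction hc using Nat.decreasingInduction with
  | self =>
    have h2 := h.avoids' (c := m) le_rfl
    have h3 := hB m le_rfl
    have h4 := h.right (m + 1) (by omega)
    rcases h.or m with ⟨e1, e2⟩ | ⟨e1, e2⟩ <;> rw [e1, h4.2] at h2 <;>
      unfold CycAvoids at * <;> unfold CycLT <;> omega
  | of_succ c hc ih =>
    have h1 := h.avoids hc
    have h2 := h.avoids' (c := c) (by omega)
    have h3 := hB c (by omega)
    have h4 := hA c hc
    have e : f' c = f c := h.eq_of_eq hg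
    rw [e, hg] at h2
    rcases h.or (c + 1) with ⟨e1, e2⟩ | ⟨e1, e2⟩
    · have := ih e2
      rw [e2] at h2
      unfold CycAvoids at *; unfold CycLT at *; omega
    · rw [e2] at h2
      unfold CycAvoids at *; unfold CycLT at *; omega

/-- The analogue of `cycLT_above` for a row `x` below that is longer than the shorter row and not
longer than the longer one. -/
lemma cycLT_below (h : RowExchange m M f g f' g')
    (hA : ∀ c, c ≤ m → CycAvoids (f c) (f (c + 1)) (x (c + 1)))
    (hB : ∀ c, c ≤ m → CycAvoids (x c) (x (c + 1)) (g c)) {c : ℕ} (hc : c ≤ m)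
    (hg : g' c = g c) : CycLT (g c) (f c) (x c) := by
  induction hc using Nat.decreasingInduction with
  | self =>
    have h2 := h.avoids' (c := m) le_rfl
    have h3 := hA m le_rfl
    have h4 := hB m le_rfl
    have h5 := h.right (m + 1) (by omega)
    rw [h.eq_of_eq hg, hg, h5.2] at h2
    unfold CycAvoids at *; unfold CycLT; omega
  | of_succ c hc ih =>
    have h1 := h.avoids hc
    have h2 := h.avoids' (c := c) (by omega)
    have h3 := hA c (by omega)
    have h4 := hB c (by omega)
    rw [h.eq_of_eq hg, hg] at h2
    rcases h.or (c + 1) with ⟨e1, e2⟩ | ⟨e1, e2⟩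
    · have := ih e2
      rw [e2] at h2
      unfold CycAvoids at *; unfold CycLT at *; omega
    · rw [e2] at h2
      unfold CycAvoids at *; unfold CycLT at *; omega

/-- The converse of `cycLT_above`: the condition after the exchange, and the cyclic order in the
basement, give the cyclic order in all columns. -/
lemma cycLT_above' (h : RowExchange m M f g f' g')
    (hA : ∀ c, c + 1 ≤ m → CycAvoids (x c) (x (c + 1)) (f' (c + 1)))
    (hB : ∀ c, c ≤ m → CycAvoids (g' c) (g' (c + 1)) (x c))
    (h0 : g' 0 = g 0 → CycLT (g 0) (f 0) (x 0)) {c : ℕ} (hc : c ≤ m)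
    (hg : g' c = g c) : CycLT (g c) (f c) (x c) := by
  induction c with
  | zero => exact h0 hg
  | succ c ih =>
    have h1 := h.avoids hc
    have h2 := h.avoids' (c := c) (by omega)
    have h3 := hA c hc
    have h4 := hB c (by omega)
    rw [hg] at h2 h4
    rw [h.eq_of_eq hg] at h3
    rcases h.or c with ⟨e1, e2⟩ | ⟨e1, e2⟩
    · have := ih (by omega) e2
      rw [e1, e2] at h2
      rw [e2] at h4
      unfold CycAvoids at *; unfold CycLT at *; omega
    · rw [e1, e2] at h2
      rw [e2] at h4
      unfold CycAvoids at *; unfold CycLT at *; omega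

/-- The converse of `cycLT_below`. -/
lemma cycLT_below' (h : RowExchange m M f g f' g')
    (hA : ∀ c, c ≤ m → CycAvoids (g' c) (g' (c + 1)) (x (c + 1)))
    (hB : ∀ c, c ≤ m → CycAvoids (x c) (x (c + 1)) (f' c))
    (h0 : g' 0 = g 0 → CycLT (g 0) (f 0) (x 0)) {c : ℕ} (hc : c ≤ m)
    (hg : g' c = g c) : CycLT (g c) (f c) (x c) := by
  induction c with
  | zero => exact h0 hg
  | succ c ih =>
    have h1 := h.avoids hc
    have h2 := h.avoids' (c := c) (by omega)
    have h3 := hA c (by omega)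
    have h4 := hB c (by omega)
    rw [hg] at h2 h3
    rcases h.or c with ⟨e1, e2⟩ | ⟨e1, e2⟩
    · have := ih (by omega) e2
      rw [e1, e2] at h2
      rw [e2] at h3
      rw [e1] at h4
      unfold CycAvoids at *; unfold CycLT at *; omega
    · rw [e1, e2] at h2
      rw [e2] at h3
      rw [e1] at h4
      unfold CycAvoids at *; unfold CycLT at *; omega

lemma pairFree_above_mid (h : RowExchange m M f g f' g') (hk : m ≤ k) (hk' : k < M)
    (hf : PairFree k M x f) (hg : PairFree k m x g) :
    PairFree k m x f' ∧ PairFree k M x g' := by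
  have hA := hg.1 hk
  have hB := hf.2 hk'
  have ho := fun c => h.cycLT_above (c := c) hA (fun c hc => hB c (by omega))
  refine ⟨⟨fun _ c hc => ?_, fun hl => by omega⟩, ⟨fun hl => by omega, fun _ c hc => ?_⟩⟩
  · have h3 := hA c hc
    rcases h.or (c + 1) with ⟨e1, e2⟩ | ⟨e1, e2⟩
    · have h1 := h.avoids hc
      have h4 := ho (c + 1) hc e2
      have h5 := hB c (by omega)
      rw [e1]
      unfold CycAvoids at *; unfold CycLT at *; omega
    · rwa [e1]
  · have h3 := hB c hc
    rcases Nat.lt_or_ge m c with hcm | hcm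
    · rwa [(h.right c hcm).2, (h.right (c + 1) (by omega)).2]
    have h2 := h.avoids' hcm
    rcases Nat.lt_or_ge c m with hcm' | hcm'
    · have h1 := h.avoids hcm'
      have h6 := hA c hcm'
      rcases h.or c with ⟨e1, e2⟩ | ⟨e1, e2⟩ <;>
        rcases h.or (c + 1) with ⟨e3, e4⟩ | ⟨e3, e4⟩ <;>
        rw [e1, e2, e4] at h2 <;> rw [e2, e4]
      · have := ho c hcm e2
        have := ho (c + 1) hcm' e4
        unfold CycAvoids at *; unfold CycLT at *; omega
      · have := ho c hcm e2
        unfold CycAvoids at *; unfold CycLT at *; omega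
      · have := ho (c + 1) hcm' e4
        unfold CycAvoids at *; unfold CycLT at *; omega
      · exact h3
    · have e4 := (h.right (c + 1) (by omega)).2
      rw [e4] at h2 ⊢
      rcases h.or c with ⟨e1, e2⟩ | ⟨e1, e2⟩ <;> rw [e1, e2] at h2 <;> rw [e2]
      · have := ho c hcm e2
        unfold CycAvoids at *; unfold CycLT at *; omega
      · exact h3

lemma pairFree_below_mid (h : RowExchange m M f g f' g') (hk : m < k) (hk' : k ≤ M)
    (hf : PairFree M k f x) (hg : PairFree m k g x) :
    PairFree m k f' x ∧ PairFree M k g' x := by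
  have hA := hf.1 hk'
  have hB := hg.2 hk
  have ho := fun c => h.cycLT_below (c := c) (fun c hc => hA c (by omega)) hB
  refine ⟨⟨fun hl => by omega, fun _ c hc => ?_⟩, ⟨fun _ c hc => ?_, fun hl => by omega⟩⟩
  · have h3 := hB c hc
    have h6 := hA c (by omega)
    have h2 := h.avoids' hc
    rcases h.or c with ⟨e1, e2⟩ | ⟨e1, e2⟩
    · have h4 := ho c hc e2
      rw [e1, e2] at h2
      rw [e1]
      rcases h.or (c + 1) with ⟨e3, e4⟩ | ⟨e3, e4⟩
      · rcases Nat.lt_or_ge c m with hcm' | hcm'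
        · have h1 := h.avoids hcm'
          have h5 := ho (c + 1) hcm' e4
          rw [e4] at h2
          unfold CycAvoids at *; unfold CycLT at *; omega
        · rw [(h.right (c + 1) (by omega)).2] at h2
          unfold CycAvoids at *; unfold CycLT at *; omega
      · rw [e4] at h2
        unfold CycAvoids at *; unfold CycLT at *; omega
    · rwa [e1]
  · have h3 := hA c hc
    rcases Nat.lt_or_ge m c with hcm | hcm
    · rwa [(h.right c hcm).2, (h.right (c + 1) (by omega)).2]
    have h2 := h.avoids' hcm
    have h6 := hB c hcm
    rcases Nat.lt_or_ge c m with hcm' | hcm'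
    · have h1 := h.avoids hcm'
      rcases h.or c with ⟨e1, e2⟩ | ⟨e1, e2⟩ <;>
        rcases h.or (c + 1) with ⟨e3, e4⟩ | ⟨e3, e4⟩ <;>
        rw [e1, e2, e4] at h2 <;> rw [e2, e4]
      · have := ho c hcm e2
        have := ho (c + 1) hcm' e4
        unfold CycAvoids at *; unfold CycLT at *; omega
      · have := ho c hcm e2
        unfold CycAvoids at *; unfold CycLT at *; omega
      · have := ho (c + 1) hcm' e4
        unfold CycAvoids at *; unfold CycLT at *; omega
      · exact h3
    · have e4 := (h.right (c + 1) (by omega)).2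
      rw [e4] at h2 ⊢
      rcases h.or c with ⟨e1, e2⟩ | ⟨e1, e2⟩ <;> rw [e1, e2] at h2 <;> rw [e2]
      · have := ho c hcm e2
        unfold CycAvoids at *; unfold CycLT at *; omega
      · exact h3

lemma pairFree_above_mid' (h : RowExchange m M f g f' g') (hk : m ≤ k) (hk' : k < M)
    (h0 : g' 0 = g 0 → CycLT (g 0) (f 0) (x 0))
    (hf : PairFree k m x f') (hg : PairFree k M x g') :
    PairFree k M x f ∧ PairFree k m x g := by
  have hA := hf.1 hk
  have hB := hg.2 hk'
  have ho := fun c => h.cycLT_above' (c := c) hA (fun c hc => hB c (by omega)) h0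
  refine ⟨⟨fun hl => by omega, fun _ c hc => ?_⟩, ⟨fun _ c hc => ?_, fun hl => by omega⟩⟩
  · have h3 := hB c hc
    rcases Nat.lt_or_ge m c with hcm | hcm
    · rwa [(h.right c hcm).2, (h.right (c + 1) (by omega)).2] at h3
    have h2 := h.avoids' hcm
    rcases Nat.lt_or_ge c m with hcm' | hcm'
    · have h1 := h.avoids hcm'
      rcases h.or c with ⟨e1, e2⟩ | ⟨e1, e2⟩ <;>
        rcases h.or (c + 1) with ⟨e3, e4⟩ | ⟨e3, e4⟩ <;>
        rw [e1, e2, e4] at h2 <;> rw [e2, e4] at h3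
      · have := ho c hcm e2
        have := ho (c + 1) hcm' e4
        unfold CycAvoids at *; unfold CycLT at *; omega
      · have := ho c hcm e2
        unfold CycAvoids at *; unfold CycLT at *; omega
      · have := ho (c + 1) hcm' e4
        unfold CycAvoids at *; unfold CycLT at *; omega
      · exact h3
    · have e4 := (h.right (c + 1) (by omega)).2
      rw [e4] at h2 h3
      rcases h.or c with ⟨e1, e2⟩ | ⟨e1, e2⟩ <;> rw [e1, e2] at h2 <;> rw [e2] at h3
      · have := ho c hcm e2
        unfold CycAvoids at *; unfold CycLT at *; omega
      · exact h3
  · have h3 := hA c hc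
    rcases h.or (c + 1) with ⟨e1, e2⟩ | ⟨e1, e2⟩
    · have h1 := h.avoids hc
      have h4 := ho (c + 1) hc e2
      have h5 := hB c (by omega)
      have h2 := h.avoids' (c := c) (by omega)
      rw [e1] at h3
      rcases h.or c with ⟨e3, e4⟩ | ⟨e3, e4⟩
      · have := ho c (by omega) e4
        rw [e2, e3, e4] at h2
        rw [e2, e4] at h5
        unfold CycAvoids at *; unfold CycLT at *; omega
      · rw [e2, e3, e4] at h2
        rw [e2, e4] at h5
        unfold CycAvoids at *; unfold CycLT at *; omega
    · rwa [e1] at h3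

lemma pairFree_below_mid' (h : RowExchange m M f g f' g') (hk : m < k) (hk' : k ≤ M)
    (h0 : g' 0 = g 0 → CycLT (g 0) (f 0) (x 0))
    (hf : PairFree m k f' x) (hg : PairFree M k g' x) :
    PairFree M k f x ∧ PairFree m k g x := by
  have hA := hg.1 hk'
  have hB := hf.2 hk
  have ho := fun c => h.cycLT_below' (c := c) (fun c hc => hA c (by omega)) hB h0
  refine ⟨⟨fun _ c hc => ?_, fun hl => by omega⟩, ⟨fun hl => by omega, fun _ c hc => ?_⟩⟩
  · have h3 := hA c hc
    rcases Nat.lt_or_ge m c with hcm | hcm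
    · rwa [(h.right c hcm).2, (h.right (c + 1) (by omega)).2] at h3
    have h2 := h.avoids' hcm
    have h6 := hB c hcm
    rcases Nat.lt_or_ge c m with hcm' | hcm'
    · have h1 := h.avoids hcm'
      rcases h.or c with ⟨e1, e2⟩ | ⟨e1, e2⟩ <;>
        rcases h.or (c + 1) with ⟨e3, e4⟩ | ⟨e3, e4⟩ <;>
        rw [e1, e2, e4] at h2 <;> rw [e2, e4] at h3 <;> rw [e1] at h6
      · have := ho c hcm e2
        have := ho (c + 1) hcm' e4
        unfold CycAvoids at *; unfold CycLT at *; omega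
      · have := ho c hcm e2
        unfold CycAvoids at *; unfold CycLT at *; omega
      · have := ho (c + 1) hcm' e4
        unfold CycAvoids at *; unfold CycLT at *; omega
      · exact h3
    · have e4 := (h.right (c + 1) (by omega)).2
      rw [e4] at h2 h3
      rcases h.or c with ⟨e1, e2⟩ | ⟨e1, e2⟩ <;> rw [e1, e2] at h2 <;> rw [e2] at h3 <;>
        rw [e1] at h6
      · have := ho c hcm e2
        unfold CycAvoids at *; unfold CycLT at *; omega
      · exact h3
  · have h3 := hB c hc
    have h5 := hA c (by omega)
    have h2 := h.avoids' hc
    rcases h.or c with ⟨e1, e2⟩ | ⟨e1, e2⟩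
    · have h4 := ho c hc e2
      rw [e1, e2] at h2
      rw [e2] at h5
      rw [e1] at h3
      unfold CycAvoids at *; unfold CycLT at *; omega
    · rwa [e1] at h3

/-- A condition on all entries of two rows may be checked before or after the exchange. -/
lemma forall_iff (h : RowExchange m M f g f' g') (s : ℕ) (P : ℕ → ℕ → Prop) :
    ((∀ c, c + s ≤ M → P c (f (c + s))) ∧ ∀ c, c + s ≤ m → P c (g (c + s))) ↔
      (∀ c, c + s ≤ m → P c (f' (c + s))) ∧ ∀ c, c + s ≤ M → P c (g' (c + s)) := by
  have hlt := h.lt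
  constructor <;> rintro ⟨h1, h2⟩ <;> refine ⟨fun c hc => ?_, fun c hc => ?_⟩
  · rcases h.or (c + s) with ⟨e1, -⟩ | ⟨e1, -⟩ <;> rw [e1]
    · exact h1 c (by omega)
    · exact h2 c hc
  · rcases Nat.lt_or_ge m (c + s) with hcm | hcm
    · rw [(h.right _ hcm).2]; exact h1 c hc
    rcases h.or (c + s) with ⟨-, e2⟩ | ⟨-, e2⟩ <;> rw [e2]
    · exact h2 c hcm
    · exact h1 c hc
  · rcases Nat.lt_or_ge m (c + s) with hcm | hcm
    · rw [← (h.right _ hcm).2]; exact h2 c hc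
    rcases h.or (c + s) with ⟨e1, -⟩ | ⟨-, e2⟩
    · rw [← e1]; exact h1 c hcm
    · rw [← e2]; exact h2 c hc
  · rcases h.or (c + s) with ⟨-, e2⟩ | ⟨e1, -⟩
    · rw [← e2]; exact h2 c (by omega)
    · rw [← e1]; exact h1 c hc

lemma pairFree_above_long (h : RowExchange m M f g f' g') (hk : M ≤ k) :
    PairFree k M x f ∧ PairFree k m x g ↔ PairFree k m x f' ∧ PairFree k M x g' := by
  have hlt := h.lt
  have := h.forall_iff 1 fun c y => CycAvoids (x c) (x (c + 1)) y
  simpa only [PairFree, hk, hlt.le.trans hk, hk.not_gt, (hlt.le.trans hk).not_gt, true_implies,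
    false_implies, and_true] using this

lemma pairFree_below_long (h : RowExchange m M f g f' g') (hk : M < k) :
    PairFree M k f x ∧ PairFree m k g x ↔ PairFree m k f' x ∧ PairFree M k g' x := by
  have hlt := h.lt.trans hk
  have := h.forall_iff 0 fun c y => CycAvoids (x c) (x (c + 1)) y
  simpa only [PairFree, hk, hlt, hk.not_ge, hlt.not_ge, true_implies,
    false_implies, true_and, Nat.add_zero] using this

lemma pairFree_above_short (h : RowExchange m M f g f' g') (hk : k < m) :
    PairFree k M x f ∧ PairFree k m x g ↔ PairFree k m x f' ∧ PairFree k M x g' := by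
  have hlt := hk.trans h.lt
  simp only [PairFree, hk, hlt, hk.not_ge, hlt.not_ge, true_implies, false_implies, true_and,
    ← forall_and]
  exact forall₂_congr fun c hc => by rw [h.avoids_both_iff (by omega)]

lemma pairFree_below_short (h : RowExchange m M f g f' g') (hk : k ≤ m) :
    PairFree M k f x ∧ PairFree m k g x ↔ PairFree m k f' x ∧ PairFree M k g' x := by
  have hlt := hk.trans h.lt.le
  simp only [PairFree, hk, hlt, hk.not_gt, hlt.not_gt, true_implies, false_implies, and_true,
    ← forall_and]
  exact forall₂_congr fun c hc => by rw [h.avoids_both_iff (by omega)]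

/-- An exchange of two rows creates no coinversion triple with a row above them. -/
lemma pairFree_above (h : RowExchange m M f g f' g')
    (hx : PairFree k M x f ∧ PairFree k m x g) : PairFree k m x f' ∧ PairFree k M x g' := by
  rcases Nat.lt_or_ge k m with h1 | h1
  · exact (h.pairFree_above_short h1).1 hx
  rcases Nat.lt_or_ge k M with h2 | h2
  · exact h.pairFree_above_mid h1 h2 hx.1 hx.2
  · exact (h.pairFree_above_long h2).1 hx

lemma pairFree_above' (h : RowExchange m M f g f' g')
    (h0 : g' 0 = g 0 → CycLT (g 0) (f 0) (x 0))
    (hx : PairFree k m x f' ∧ PairFree k M x g') : PairFree k M x f ∧ PairFree k m x g := by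
  rcases Nat.lt_or_ge k m with h1 | h1
  · exact (h.pairFree_above_short h1).2 hx
  rcases Nat.lt_or_ge k M with h2 | h2
  · exact h.pairFree_above_mid' h1 h2 h0 hx.1 hx.2
  · exact (h.pairFree_above_long h2).2 hx

/-- An exchange of two rows creates no coinversion triple with a row below them. -/
lemma pairFree_below (h : RowExchange m M f g f' g')
    (hx : PairFree M k f x ∧ PairFree m k g x) : PairFree m k f' x ∧ PairFree M k g' x := by
  rcases Nat.lt_or_ge m k with h1 | h1
  · rcases Nat.lt_or_ge M k with h2 | h2
    · exact (h.pairFree_below_long h2).1 hx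
    · exact h.pairFree_below_mid h1 h2 hx.1 hx.2
  · exact (h.pairFree_below_short h1).1 hx

lemma pairFree_below' (h : RowExchange m M f g f' g')
    (h0 : g' 0 = g 0 → CycLT (g 0) (f 0) (x 0))
    (hx : PairFree m k f' x ∧ PairFree M k g' x) : PairFree M k f x ∧ PairFree m k g x := by
  rcases Nat.lt_or_ge m k with h1 | h1
  · rcases Nat.lt_or_ge M k with h2 | h2
    · exact (h.pairFree_below_long h2).2 hx
    · exact h.pairFree_below_mid' h1 h2 h0 hx.1 hx.2
  · exact (h.pairFree_below_short h1).2 hx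

/-! ### Existence and uniqueness of exchanges -/

/-- The entries of the upper row of `F` are determined from left to right by the column sets. -/
lemma left_unique {f₂ g₂ : ℕ → ℕ} (h : RowExchange m M f g f' g')
    (h₂ : RowExchange m M f₂ g₂ f' g') (h0 : f 0 = f₂ 0) : f = f₂ ∧ g = g₂ := by
  have hf : ∀ c, f c = f₂ c := by
    intro c
    induction c with
    | zero => exact h0
    | succ c ih =>
      rcases Nat.lt_or_ge m (c + 1) with hc | hc
      · rw [← (h.right _ hc).2, ← (h₂.right _ hc).2]
      have h1 := h.avoids hc
      have h2 := h₂.avoids hc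
      rw [← ih] at h2
      -- Otherwise the two upper rows make opposite choices from the same two entries.
      by_contra hne
      refine h1.asymm_right ?_
      rcases h.or (c + 1) with ⟨e1, e2⟩ | ⟨e1, e2⟩ <;>
        rcases h₂.or (c + 1) with ⟨e3, e4⟩ | ⟨e3, e4⟩
      · exact absurd (e1.symm.trans e3) hne
      · rwa [← e1, ← e2, e4, e3] at *
      · rwa [← e1, ← e2, e4, e3] at *
      · exact absurd (e2.symm.trans e4) hne
  refine ⟨funext hf, funext fun c => ?_⟩
  have := hf c
  rcases h.or c with ⟨e1, e2⟩ | ⟨e1, e2⟩ <;> rcases h₂.or c with ⟨e3, e4⟩ | ⟨e3, e4⟩ <;> omega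

/-- The entries of the lower row of `F'` are determined from right to left by the column sets. -/
lemma right_unique {f₂ g₂ : ℕ → ℕ} (h : RowExchange m M f g f' g')
    (h₂ : RowExchange m M f g f₂ g₂) : f' = f₂ ∧ g' = g₂ := by
  have hgt : ∀ c, m < c → g' c = g₂ c := fun c hc => by rw [(h.right _ hc).2, (h₂.right _ hc).2]
  have hle : ∀ c, c ≤ m + 1 → g' c = g₂ c := by
    intro c hc
    induction hc using Nat.decreasingInduction with
    | self => exact hgt _ (by omega)
    | of_succ c hc ih =>
      have h1 := h.avoids' (c := c) (by omega)
      have h2 := h₂.avoids' (c := c) (by omega)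
      rw [← ih] at h2
      -- Otherwise the two lower rows make opposite choices from the same two entries.
      by_contra hne
      refine h1.asymm_left ?_
      rcases h.or c with ⟨e1, e2⟩ | ⟨e1, e2⟩ <;> rcases h₂.or c with ⟨e3, e4⟩ | ⟨e3, e4⟩
      · exact absurd (e2.trans e4.symm) hne
      · rwa [e1, e2, ← e3, ← e4]
      · rwa [e1, e2, ← e3, ← e4]
      · exact absurd (e2.trans e4.symm) hne
  have hg : ∀ c, g' c = g₂ c := fun c => by
    rcases Nat.lt_or_ge m c with hc | hc
    · exact hgt c hc
    · exact hle c (by omega)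
  refine ⟨funext fun c => ?_, funext hg⟩
  have := hg c
  rcases h.or c with ⟨e1, e2⟩ | ⟨e1, e2⟩ <;> rcases h₂.or c with ⟨e3, e4⟩ | ⟨e3, e4⟩ <;> omega

end RowExchange

/-- The lower row of `F'`, filled from right to left. -/
def bottomRow (m : ℕ) (f g : ℕ → ℕ) (c : ℕ) : ℕ :=
  if c ≤ m then bottomChoice (f c) (g c) (bottomRow m f g (c + 1)) else f c
termination_by m + 1 - c

/-- The upper row of `F`, recovered from left to right from the rows `f'`, `g'` of `F'` and the
basement entry `a`. -/
def topRow (m a : ℕ) (f' g' : ℕ → ℕ) : ℕ → ℕ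
  | 0 => a
  | c + 1 => if c + 1 ≤ m then topChoice (f' (c + 1)) (g' (c + 1)) (topRow m a f' g' c)
      else g' (c + 1)

/-- Filling the lower row from right to left by `bottomChoice` produces an exchange. -/
lemma exists_rowExchange_of_pair {m M : ℕ} {f g : ℕ → ℕ} (hlt : m < M) (h : PairFree M m f g)
    (h0 : f 0 ≠ g 0) : ∃ f' g', RowExchange m M f g f' g' := by
  have hne : ∀ c, c ≤ m → f c ≠ g c := by
    rintro (_ | c) hc
    · exact h0
    · exact (h.1 hlt.le c hc).ne'
  have hb : ∀ c, c ≤ m →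
      bottomRow m f g c = bottomChoice (f c) (g c) (bottomRow m f g (c + 1)) := fun c hc => by
    rw [bottomRow, if_pos hc]
  have hr : ∀ c, m < c → bottomRow m f g c = f c := fun c hc => by
    rw [bottomRow, if_neg (by omega)]
  refine ⟨fun c => if bottomRow m f g c = f c then g c else f c, bottomRow m f g,
    hlt, fun c => ?_, fun c hc => ?_, h, fun hl => by omega, fun _ c hc => ?_⟩
  · rcases Nat.lt_or_ge m c with hc | hc
    · simp [hr c hc]
    rcases cycAvoids_bottomChoice (hne c hc) (hb c hc) with ⟨e, -⟩ | ⟨e, -⟩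
    · simp [e]
    · simp [e, (hne c hc).symm]
  · simp [hr c hc]
  · rcases cycAvoids_bottomChoice (hne c hc) (hb c hc) with ⟨e, h⟩ | ⟨e, h⟩
    · simpa [e] using h
    · simpa [e, (hne c hc).symm] using h

/-- Filling the upper row from left to right by `topChoice` undoes an exchange; the order of the two
basement entries of `f`, `g` is prescribed. -/
lemma exists_rowExchange_of_pair' {m M a b : ℕ} {f' g' : ℕ → ℕ} (hlt : m < M)
    (h : PairFree m M f' g') (hab : (f' 0 = a ∧ g' 0 = b) ∨ (f' 0 = b ∧ g' 0 = a)) :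
    ∃ f g, RowExchange m M f g f' g' ∧ f 0 = a ∧ g 0 = b := by
  have hne : ∀ c, c ≤ m → f' c ≠ g' c := fun c hc => (h.2 hlt c hc).ne.symm
  set t := topRow m a f' g' with ht
  have hb : ∀ c, c + 1 ≤ m → t (c + 1) = topChoice (f' (c + 1)) (g' (c + 1)) (t c) :=
    fun c hc => by rw [ht, topRow, if_pos hc]
  have h0 : t 0 = a := rfl
  have hr : ∀ c, m < c → t c = g' c := by
    rintro (_ | c) hc
    · omega
    · rw [ht, topRow, if_neg (by omega)]
  have hne0 := hne 0 (Nat.zero_le _)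
  refine ⟨t, fun c => if t c = g' c then f' c else g' c,
    ⟨hlt, fun c => ?_, fun c hc => ?_, ⟨fun _ c hc => ?_, fun hl => by omega⟩, h⟩, h0, ?_⟩
  · rcases Nat.lt_or_ge m c with hc | hc
    · simp [hr c hc]
    rcases c with _ | c
    · rcases hab with ⟨h1, h2⟩ | ⟨h1, h2⟩
      · exact Or.inl ⟨h1.trans h0.symm, (if_neg (by omega)).symm⟩
      · exact Or.inr ⟨(if_pos (by omega)).symm, h2.trans h0.symm⟩
    rcases cycAvoids_topChoice (hne _ hc) (hb c hc) with ⟨e, -⟩ | ⟨e, -⟩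
    · simp [e, hne _ hc]
    · simp [e]
  · simp [hr c hc]
  · rcases cycAvoids_topChoice (hne _ hc) (hb c hc) with ⟨e, h⟩ | ⟨e, h⟩
    · have : t (c + 1) ≠ g' (c + 1) := by rw [e]; exact hne _ hc
      simpa only [this, if_false] using h
    · simpa only [e, if_true] using h
  · rcases hab with ⟨h1, h2⟩ | ⟨h1, h2⟩
    · exact (if_neg (by omega)).trans h2
    · exact (if_pos (by omega)).trans h1

/-! ### Descents -/

/-- The number of descents of a row in the columns `1, …, k`. -/
def desCount (f : ℕ → ℕ) : ℕ → ℕ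
  | 0 => 0
  | k + 1 => desCount f k + if f k < f (k + 1) then 1 else 0

/-- The contribution to the major index of a row of length `k`. -/
def rowMaj (f : ℕ → ℕ) (k : ℕ) : ℕ :=
  ∑ c ∈ Finset.Icc 1 k, if f (c - 1) < f c then k - c + 1 else 0

lemma desCount_eq_sum (f : ℕ → ℕ) (k : ℕ) :
    desCount f k = ∑ c ∈ Finset.Icc 1 k, if f (c - 1) < f c then 1 else 0 := by
  induction k with
  | zero => rfl
  | succ k ih => rw [desCount, ih, Finset.sum_Icc_succ_top (by omega)]; rfl

/-- Extending a row by one box raises the leg of each descent by one. -/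
lemma rowMaj_succ (f : ℕ → ℕ) (k : ℕ) :
    rowMaj f (k + 1) = rowMaj f k + desCount f (k + 1) := by
  rw [desCount_eq_sum, rowMaj, rowMaj, Finset.sum_Icc_succ_top (by omega),
    Finset.sum_Icc_succ_top (by omega), ← add_assoc, ← Finset.sum_add_distrib]
  congr 1
  · refine Finset.sum_congr rfl fun c hc => ?_
    rw [Finset.mem_Icc] at hc
    split_ifs <;> omega
  · simp

namespace RowExchange

variable {m M k : ℕ} {f g f' g' : ℕ → ℕ}

lemma desCount_add (h : RowExchange m M f g f' g') (hk : k ≤ m) :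
    desCount f k + desCount g k = desCount f' k + desCount g' k := by
  induction k with
  | zero => rfl
  | succ k ih =>
    have := ih (by omega)
    have h1 := h.avoids hk
    have h2 := h.avoids' (c := k) (by omega)
    simp only [desCount]
    rcases h.or k with ⟨e1, e2⟩ | ⟨e1, e2⟩ <;> rcases h.or (k + 1) with ⟨e3, e4⟩ | ⟨e3, e4⟩ <;>
      rw [e1, e2, e4] at h2 <;> rw [e1, e2, e3, e4] <;> unfold CycAvoids at * <;>
      split_ifs <;> omega

/-- The long rows before and after the exchange, followed from column `m + 1` back to column `c`,
have the same number of descents, unless their entries in column `c`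
differ and the long row of `F` has the smaller one, in which case it has one more. (Lift the rows to the integers so that each step goes down by the
cyclic distance: the two lifts stay within one period of each other.) -/
lemma desCount_tail (h : RowExchange m M f g f' g') {c : ℕ} (hc : c ≤ m + 1) :
    (g' c = f c ∧ desCount f (m + 1) + desCount g' c = desCount g' (m + 1) + desCount f c) ∨
    (c ≤ m ∧ g' c = g c ∧ g c < f c ∧
      desCount f (m + 1) + desCount g' c = desCount g' (m + 1) + desCount f c) ∨
    (c ≤ m ∧ g' c = g c ∧ f c < g c ∧
      desCount f (m + 1) + desCount g' c = desCount g' (m + 1) + desCount f c + 1) := by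
  induction hc using Nat.decreasingInduction with
  | self => exact Or.inl ⟨(h.right _ (by omega)).2, by omega⟩
  | of_succ c hc ih =>
    have h2 := h.avoids' (c := c) (by omega)
    have d1 : desCount f (c + 1) = desCount f c + if f c < f (c + 1) then 1 else 0 := rfl
    have d2 : desCount g' (c + 1) = desCount g' c + if g' c < g' (c + 1) then 1 else 0 := rfl
    rw [d1, d2] at ih
    have h1 : c + 1 ≤ m → CycAvoids (f c) (f (c + 1)) (g (c + 1)) := h.avoids
    unfold CycAvoids at *
    rcases h.or c with ⟨e1, e2⟩ | ⟨e1, e2⟩ <;> rw [e1, e2] at h2 <;> rw [e2] at ih ⊢ <;>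
      rcases ih with ⟨e3, ih⟩ | ⟨hcm, e3, hlt, ih⟩ | ⟨hcm, e3, hlt, ih⟩ <;> rw [e3] at h2 ih <;>
      split_ifs at ih <;> omega

/-- In the basement the exceptional case of `desCount_tail` is excluded by `g 0 < f 0`. -/
lemma desCount_long (h : RowExchange m M f g f' g') (h0 : g 0 < f 0) (hk : m < k) :
    desCount f k = desCount g' k := by
  induction hk with
  | refl =>
    have := h.desCount_tail (c := 0) (by omega)
    simp only [desCount] at this ⊢
    omega
  | step hk ih =>
    rw [desCount, desCount, ih, (h.right _ hk).2, (h.right _ (Nat.lt_succ_of_lt hk)).2]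

lemma rowMaj_add (h : RowExchange m M f g f' g') (h0 : g 0 < f 0) :
    rowMaj f M + rowMaj g m = rowMaj f' m + rowMaj g' M := by
  have hle : ∀ k, k ≤ m → rowMaj f k + rowMaj g k = rowMaj f' k + rowMaj g' k := by
    intro k hk
    induction k with
    | zero => rfl
    | succ k ih =>
      have := ih (by omega)
      have := h.desCount_add hk
      simp only [rowMaj_succ]; omega
  have hge : ∀ k, m ≤ k → rowMaj f k + rowMaj g m = rowMaj f' m + rowMaj g' k := by
    intro k hk
    induction hk with
    | refl => exact hle m le_rfl
    | step hk ih =>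
      rw [rowMaj_succ, rowMaj_succ, h.desCount_long h0 (Nat.lt_succ_of_le hk), ← add_assoc, ← ih]
      exact add_right_comm _ _ _
  exact hge M h.lt.le

end RowExchange

/-! ### Fillings -/

/-- The entries `e` have no coinversion triples in the shape `α`. -/
def EntriesCoinvFree {n : ℕ} (α : Fin n → ℕ) (e : Fin n → ℕ → ℕ) : Prop :=
  ∀ r t : Fin n, r < t → PairFree (α r) (α t) (e r) (e t)

lemma Filling.isCoinvFree_iff {n : ℕ} {α : Fin n → ℕ} {σ : Equiv.Perm (Fin n)}
    (F : Filling α σ) : F.IsCoinvFree ↔ EntriesCoinvFree α F.entry := by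
  simp only [Filling.IsCoinvFree, inversionA_iff, inversionB_iff]
  constructor
  · rintro ⟨hA, hB⟩ r t hrt
    exact ⟨fun h c hc => hA r t c hrt h (by omega) hc,
      fun h c hc => hB t r c hrt h (by omega) hc⟩
  · intro h
    exact ⟨fun r t c hrt hl _ hc => (h r t hrt).1 hl c hc,
      fun r t c hrt hl _ hc => (h t r hrt).2 hl c hc⟩

/-- The entries `e'` arise from `e`, a family of rows of lengths `α`, by an exchange of the rows
`i` and `j`. -/
structure EntryExchange {n : ℕ} (α : Fin n → ℕ) (i j : Fin n) (e e' : Fin n → ℕ → ℕ) : Prop where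
  other : ∀ r, r ≠ i → r ≠ j → e' r = e r
  rows : RowExchange (α j) (α i) (e i) (e j) (e' i) (e' j)

variable {n : ℕ} {α : Fin n → ℕ} {σ : Equiv.Perm (Fin n)} {i j : Fin n} {e e' : Fin n → ℕ → ℕ}

lemma swapShape_left : swapShape i j α i = α j := by simp [swapShape]

lemma swapShape_right : swapShape i j α j = α i := by simp [swapShape]

lemma swapShape_of_ne {r : Fin n} (hi : r ≠ i) (hj : r ≠ j) : swapShape i j α r = α r := by
  simp [swapShape, Equiv.swap_apply_of_ne_of_ne hi hj]

namespace EntryExchange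

/-- In every column the exchange acts by a permutation of the rows that is compatible with the
shapes. -/
lemma exists_perm (h : EntryExchange α i j e e') (c : ℕ) :
    ∃ π : Equiv.Perm (Fin n), (π = 1 ∨ π = Equiv.swap i j) ∧
      ∀ r, e' r c = e (π r) c ∧ (c ≤ swapShape i j α r ↔ c ≤ α (π r)) := by
  have hlt := h.rows.lt
  have key : ∀ π : Equiv.Perm (Fin n), (π = 1 ∨ π = Equiv.swap i j) →
      (e' i c = e (π i) c ∧ (c ≤ α j ↔ c ≤ α (π i))) →
      (e' j c = e (π j) c ∧ (c ≤ α i ↔ c ≤ α (π j))) →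
      ∀ r, e' r c = e (π r) c ∧ (c ≤ swapShape i j α r ↔ c ≤ α (π r)) := by
    intro π hπ h1 h2 r
    by_cases hi : r = i
    · rw [hi, swapShape_left]; exact h1
    by_cases hj : r = j
    · rw [hj, swapShape_right]; exact h2
    have : π r = r := by
      rcases hπ with rfl | rfl
      · rfl
      · exact Equiv.swap_apply_of_ne_of_ne hi hj
    rw [this, swapShape_of_ne hi hj, h.other r hi hj]
    exact ⟨rfl, Iff.rfl⟩
  rcases Nat.lt_or_ge (α j) c with hc | hc
  · have := h.rows.right c hc
    refine ⟨_, Or.inr rfl, key _ (Or.inr rfl) ?_ ?_⟩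
    · rw [Equiv.swap_apply_left]; exact ⟨this.1, Iff.rfl⟩
    · rw [Equiv.swap_apply_right]; exact ⟨this.2, Iff.rfl⟩
  · rcases h.rows.or c with ⟨e1, e2⟩ | ⟨e1, e2⟩
    · exact ⟨_, Or.inl rfl, key _ (Or.inl rfl) ⟨e1, by simp only [Equiv.Perm.one_apply]; omega⟩
        ⟨e2, by simp only [Equiv.Perm.one_apply]; omega⟩⟩
    · refine ⟨_, Or.inr rfl, key _ (Or.inr rfl) ?_ ?_⟩
      · rw [Equiv.swap_apply_left]; exact ⟨e1, Iff.rfl⟩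
      · rw [Equiv.swap_apply_right]; exact ⟨e2, Iff.rfl⟩

lemma exists_perm' (h : EntryExchange α i j e e') (c : ℕ) :
    ∃ π : Equiv.Perm (Fin n), (π = 1 ∨ π = Equiv.swap i j) ∧
      ∀ r, e r c = e' (π r) c ∧ (c ≤ α r ↔ c ≤ swapShape i j α (π r)) := by
  obtain ⟨π, hπ, h⟩ := h.exists_perm c
  have hinv : ∀ r, π (π r) = r := by rcases hπ with rfl | rfl <;> simp
  refine ⟨π, hπ, fun r => ?_⟩
  have := h (π r)
  rw [hinv] at this
  exact ⟨this.1.symm, this.2.symm⟩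

lemma coinvFree (h : EntryExchange α i j e e') (hij : (j : ℕ) = i + 1)
    (he : EntriesCoinvFree α e) : EntriesCoinvFree (swapShape i j α) e' := by
  have hne : i ≠ j := fun h => by rw [h] at hij; omega
  have habove : ∀ r, r < i → PairFree (α r) (α j) (e r) (e' i) ∧
      PairFree (α r) (α i) (e r) (e' j) := fun r hr =>
    h.rows.pairFree_above ⟨he r i hr, he r j (by omega)⟩
  have hbelow : ∀ r, j < r → PairFree (α j) (α r) (e' i) (e r) ∧
      PairFree (α i) (α r) (e' j) (e r) := fun r hr =>
    h.rows.pairFree_below ⟨he i r (by omega), he j r hr⟩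
  intro r t hrt
  by_cases hri : r = i
  · subst hri
    by_cases htj : t = j
    · subst htj
      rw [swapShape_left, swapShape_right]; exact h.rows.pair'
    have hti : t ≠ r := hrt.ne'
    rw [swapShape_left, swapShape_of_ne hti htj, h.other t hti htj]
    exact (hbelow t (by omega)).1
  by_cases hrj : r = j
  · subst hrj
    have hti : t ≠ i := by omega
    rw [swapShape_right, swapShape_of_ne hti hrt.ne', h.other t hti hrt.ne']
    exact (hbelow t hrt).2
  rw [swapShape_of_ne hri hrj, h.other r hri hrj]
  by_cases hti : t = i
  · subst hti
    rw [swapShape_left]; exact (habove r hrt).1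
  by_cases htj : t = j
  · subst htj
    rw [swapShape_right]; exact (habove r (by omega)).2
  rw [swapShape_of_ne hti htj, h.other t hti htj]
  exact he r t hrt

/-- The converse of `coinvFree`, which needs a condition on the basement in order to start the
induction from left to right. -/
lemma coinvFree' (h : EntryExchange α i j e e') (hij : (j : ℕ) = i + 1)
    (h0 : ∀ r, r ≠ i → r ≠ j → e' j 0 = e j 0 → CycLT (e j 0) (e i 0) (e r 0))
    (he : EntriesCoinvFree (swapShape i j α) e') : EntriesCoinvFree α e := by
  have hne : i ≠ j := fun h => by rw [h] at hij; omega
  have habove : ∀ r, r < i → PairFree (α r) (α i) (e r) (e i) ∧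
      PairFree (α r) (α j) (e r) (e j) := by
    intro r hr
    have hri : r ≠ i := hr.ne
    have hrj : r ≠ j := by omega
    have h1 := he r i hr
    have h2 := he r j (by omega)
    rw [swapShape_of_ne hri hrj, h.other r hri hrj] at h1 h2
    rw [swapShape_left] at h1
    rw [swapShape_right] at h2
    exact h.rows.pairFree_above' (h0 r hri hrj) ⟨h1, h2⟩
  have hbelow : ∀ r, j < r → PairFree (α i) (α r) (e i) (e r) ∧
      PairFree (α j) (α r) (e j) (e r) := by
    intro r hr
    have hri : r ≠ i := by omega
    have hrj : r ≠ j := hr.ne'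
    have h1 := he i r (by omega)
    have h2 := he j r hr
    rw [swapShape_of_ne hri hrj, h.other r hri hrj] at h1 h2
    rw [swapShape_left] at h1
    rw [swapShape_right] at h2
    exact h.rows.pairFree_below' (h0 r hri hrj) ⟨h1, h2⟩
  intro r t hrt
  by_cases hri : r = i
  · subst hri
    by_cases htj : t = j
    · subst htj
      exact h.rows.pair
    exact (hbelow t (by omega)).1
  by_cases hrj : r = j
  · subst hrj
    exact (hbelow t hrt).2
  by_cases hti : t = i
  · subst hti
    exact (habove r hrt).1
  by_cases htj : t = j
  · subst htj
    exact (habove r (by omega)).2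
  have := he r t hrt
  rwa [swapShape_of_ne hri hrj, h.other r hri hrj, swapShape_of_ne hti htj,
    h.other t hti htj] at this

/-- The type `B` condition on the exchanged rows is the filling rule. -/
lemma fillingRule (h : EntryExchange α i j e e') : FillingRule α i j e e' := by
  refine ⟨h.other, fun c hc _ => (h.rows.right c hc).2, fun c hc => ?_⟩
  have h2 := h.rows.avoids' hc
  rcases h.rows.or c with ⟨e1, e2⟩ | ⟨e1, e2⟩
  · rw [e1, e2] at h2 ⊢
    exact ⟨(eq_bottomChoice h2).2, rfl⟩
  · rw [e1, e2] at h2 ⊢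
    exact ⟨(eq_bottomChoice h2).1, Multiset.pair_comm _ _⟩

lemma columnSet_eq (h : EntryExchange α i j e e') (c : ℕ) :
    ((Finset.univ.filter fun r : Fin n => c ≤ swapShape i j α r).val.map fun r => e' r c) =
      (Finset.univ.filter fun r : Fin n => c ≤ α r).val.map fun r => e r c := by
  obtain ⟨π, -, hπ⟩ := h.exists_perm c
  have : (Finset.univ.filter fun r : Fin n => c ≤ α r) =
      (Finset.univ.filter fun r : Fin n => c ≤ swapShape i j α r).map π.toEmbedding := by
    ext r
    simp only [Finset.mem_filter, Finset.mem_univ, true_and, Finset.mem_map_equiv, (hπ _).2,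
      Equiv.apply_symm_apply]
  rw [this, Finset.map_val, Multiset.map_map]
  exact Multiset.map_congr rfl fun r _ => (hπ r).1

lemma sum_rowMaj_eq (h : EntryExchange α i j e e') (h0 : e j 0 < e i 0) :
    ∑ r, rowMaj (e' r) (swapShape i j α r) = ∑ r, rowMaj (e r) (α r) := by
  have hne : i ≠ j := fun h' => by rw [h'] at h0; omega
  -- All rows other than `i` and `j` contribute the same on both sides.
  have hsplit : ∀ s : Fin n → ℕ, ∑ r, s r = s i + s j + ∑ r ∈ {i, j}ᶜ, s r := fun s => by
    rw [← Finset.sum_pair hne, Finset.sum_add_sum_compl]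
  rw [hsplit, hsplit, swapShape_left, swapShape_right, h.rows.rowMaj_add h0]
  congr 1
  refine Finset.sum_congr rfl fun r hr => ?_
  simp only [Finset.mem_compl, Finset.mem_insert, Finset.mem_singleton, not_or] at hr
  rw [h.other r hr.1 hr.2, swapShape_of_ne hr.1 hr.2]

end EntryExchange

namespace Target

lemma entriesCoinvFree (G : Target α σ i j) : EntriesCoinvFree (swapShape i j α) G.entry := by
  rcases G with H | H <;> exact (Filling.isCoinvFree_iff H.1).1 H.2

lemma entry_mem (G : Target α σ i j) (r : Fin n) (c : ℕ) (hc : c ≤ swapShape i j α r) :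
    G.entry r c ∈ Set.Icc 1 n := by
  rcases G with H | H <;> exact H.1.entry_mem r c hc

lemma entry_outside (G : Target α σ i j) (r : Fin n) (c : ℕ) (hc : swapShape i j α r < c) :
    G.entry r c = 0 := by
  rcases G with H | H <;> exact H.1.entry_outside r c hc

lemma basement (G : Target α σ i j) : ∃ π : Equiv.Perm (Fin n), (π = 1 ∨ π = Equiv.swap i j) ∧
    ∀ r, G.entry r 0 = (σ (π r) : ℕ) + 1 := by
  rcases G with H | H
  · exact ⟨1, Or.inl rfl, H.1.basement⟩
  · exact ⟨_, Or.inr rfl, H.1.basement⟩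

/-- The two parts of the disjoint union are told apart by the basement, so that the entries
determine an element. -/
lemma entry_injective (hij : i ≠ j) :
    Function.Injective (entry : Target α σ i j → Fin n → ℕ → ℕ) := by
  have hdis : ∀ (H : CoInvFree (swapShape i j α) σ)
      (K : CoInvFree (swapShape i j α) (swapBasement i j σ)), H.1.entry ≠ K.1.entry := by
    intro H K h
    have h1 := H.1.basement i
    rw [h, K.1.basement i] at h1
    have h2 : σ j = σ i := Fin.ext (by simpa [swapBasement] using h1)
    exact hij (σ.injective h2.symm)
  rintro (H | H) (K | K) h
  · exact congrArg Sum.inl (Subtype.ext (Filling.ext h))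
  · exact absurd h (hdis H K)
  · exact absurd h.symm (hdis K H)
  · exact congrArg Sum.inr (Subtype.ext (Filling.ext h))

lemma maj_eq (G : Target α σ i j) : G.maj = ∑ r, rowMaj (G.entry r) (swapShape i j α r) := by
  rcases G with H | H <;> rfl

lemma columnSet_eq (G : Target α σ i j) (c : ℕ) :
    G.columnSet c =
      (Finset.univ.filter fun r : Fin n => c ≤ swapShape i j α r).val.map fun r => G.entry r c := by
  rcases G with H | H <;> rfl

end Target

/-- Every coinversion-free filling of shape `α` has an image under the filling rule. -/
lemma exists_target (hij : (j : ℕ) = i + 1) (hα : α j < α i) (F : CoInvFree α σ) :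
    ∃ G : Target α σ i j, EntryExchange α i j F.1.entry G.entry := by
  have hlt : i < j := by omega
  have hF := (Filling.isCoinvFree_iff F.1).1 F.2
  have h0 : F.1.entry i 0 ≠ F.1.entry j 0 := by
    rw [F.1.basement, F.1.basement]
    intro h
    exact hlt.ne (σ.injective (Fin.ext (by omega)))
  obtain ⟨f', g', hrow⟩ := exists_rowExchange_of_pair hα (hF i j hlt) h0
  set e' : Fin n → ℕ → ℕ := fun r => if r = i then f' else if r = j then g' else F.1.entry r
  have hei : e' i = f' := if_pos rfl
  have hej : e' j = g' := (if_neg hlt.ne').trans (if_pos rfl)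
  have hex : EntryExchange α i j F.1.entry e' :=
    ⟨fun r hi hj => (if_neg hi).trans (if_neg hj), by rwa [hei, hej]⟩
  have hfree := hex.coinvFree hij hF
  have hmem : ∀ r c, c ≤ swapShape i j α r → e' r c ∈ Set.Icc 1 n := fun r c hc => by
    obtain ⟨π, -, hπ⟩ := hex.exists_perm c
    rw [(hπ r).1]
    exact F.1.entry_mem _ _ ((hπ r).2.1 hc)
  have hout : ∀ r c, swapShape i j α r < c → e' r c = 0 := fun r c hc => by
    obtain ⟨π, -, hπ⟩ := hex.exists_perm c
    rw [(hπ r).1]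
    exact F.1.entry_outside _ _ (by have := (hπ r).2; omega)
  obtain ⟨π, hπ, h⟩ := hex.exists_perm 0
  rcases hπ with rfl | rfl
  · exact ⟨Sum.inl ⟨⟨e', fun r => (h r).1.trans (F.1.basement _), hmem, hout⟩,
      (Filling.isCoinvFree_iff _).2 hfree⟩, hex⟩
  · exact ⟨Sum.inr ⟨⟨e', fun r => (h r).1.trans (F.1.basement _), hmem, hout⟩,
      (Filling.isCoinvFree_iff _).2 hfree⟩, hex⟩

/-- If `σ i` and `σ j` are consecutive, every element of the disjoint union has a preimage:
whatever the entry `σ r` of another row is, `σ j`, `σ i`, `σ r` are in increasing cyclic order. -/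
lemma exists_preimage (hij : (j : ℕ) = i + 1) (hα : α j < α i) (hσ : (σ i : ℕ) = σ j + 1)
    (G : Target α σ i j) : ∃ F : CoInvFree α σ, EntryExchange α i j F.1.entry G.entry := by
  have hlt : i < j := by omega
  have hpair := G.entriesCoinvFree i j hlt
  rw [swapShape_left, swapShape_right] at hpair
  have hb : (G.entry i 0 = (σ i : ℕ) + 1 ∧ G.entry j 0 = (σ j : ℕ) + 1) ∨
      (G.entry i 0 = (σ j : ℕ) + 1 ∧ G.entry j 0 = (σ i : ℕ) + 1) := by
    obtain ⟨π, rfl | rfl, h⟩ := G.basement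
    · exact Or.inl ⟨h i, h j⟩
    · exact Or.inr ⟨by rw [h, Equiv.swap_apply_left], by rw [h, Equiv.swap_apply_right]⟩
  obtain ⟨f, g, hrow, hf0, hg0⟩ := exists_rowExchange_of_pair' hα hpair hb
  set e : Fin n → ℕ → ℕ := fun r => if r = i then f else if r = j then g else G.entry r
  have hei : e i = f := if_pos rfl
  have hej : e j = g := (if_neg hlt.ne').trans (if_pos rfl)
  have heo : ∀ r, r ≠ i → r ≠ j → e r = G.entry r :=
    fun r hi hj => (if_neg hi).trans (if_neg hj)
  have hex : EntryExchange α i j e G.entry :=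
    ⟨fun r hi hj => (heo r hi hj).symm, by rwa [hei, hej]⟩
  have hbase : ∀ r, e r 0 = (σ r : ℕ) + 1 := by
    intro r
    by_cases hi : r = i
    · rw [hi, hei, hf0]
    by_cases hj : r = j
    · rw [hj, hej, hg0]
    rw [heo r hi hj]
    obtain ⟨π, rfl | rfl, h⟩ := G.basement
    · exact h r
    · rw [h, Equiv.swap_apply_of_ne_of_ne hi hj]
  have hfree : EntriesCoinvFree α e := by
    refine hex.coinvFree' hij (fun r hi hj _ => ?_) G.entriesCoinvFree
    have h1 : (σ r : ℕ) ≠ σ i := fun h => hi (σ.injective (Fin.ext h))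
    have h2 : (σ r : ℕ) ≠ σ j := fun h => hj (σ.injective (Fin.ext h))
    rw [hbase, hbase, hbase]
    unfold CycLT
    omega
  refine ⟨⟨⟨e, hbase, fun r c hc => ?_, fun r c hc => ?_⟩,
    (Filling.isCoinvFree_iff _).2 hfree⟩, hex⟩
  · obtain ⟨π, -, hπ⟩ := hex.exists_perm' c
    rw [(hπ r).1]
    exact G.entry_mem _ _ ((hπ r).2.1 hc)
  · obtain ⟨π, -, hπ⟩ := hex.exists_perm' c
    rw [(hπ r).1]
    exact G.entry_outside _ _ (by have := (hπ r).2; omega)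

end ColSet

theorem mainTheorem1 {n : ℕ} (α : Fin n → ℕ) (σ : Equiv.Perm (Fin n)) (i j : Fin n)
    (hij : (j : ℕ) = (i : ℕ) + 1) (hσ : σ j < σ i) (hα : α j < α i) :
    ∃ φ : ColSet.CoInvFree α σ → ColSet.Target α σ i j,
      (∀ F, ColSet.FillingRule α i j F.1.entry (φ F).entry) ∧
      Function.Injective φ ∧
      (∀ F c, (φ F).columnSet c = F.1.columnSet c) ∧
      (∀ F, (φ F).maj = F.1.maj) ∧
      ((σ i : ℕ) = (σ j : ℕ) + 1 → Function.Bijective φ) := by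
  have hne : i ≠ j := fun h => by rw [h] at hij; omega
  choose φ hφ using fun F : ColSet.CoInvFree α σ => ColSet.exists_target hij hα F
  have hinj : Function.Injective φ := by
    intro F₁ F₂ h
    have h1 := hφ F₁
    have h2 := hφ F₂
    rw [← h] at h2
    obtain ⟨hi, hj⟩ := h1.rows.left_unique h2.rows (by rw [F₁.1.basement, F₂.1.basement])
    refine Subtype.ext (ColSet.Filling.ext (funext fun r => ?_))
    by_cases hri : r = i
    · rw [hri, hi]
    by_cases hrj : r = j
    · rw [hrj, hj]
    rw [← h1.other r hri hrj, ← h2.other r hri hrj]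
  refine ⟨φ, fun F => (hφ F).fillingRule, hinj, fun F c => ?_, fun F => ?_,
    fun h => ⟨hinj, fun G => ?_⟩⟩
  · rw [ColSet.Target.columnSet_eq]
    exact (hφ F).columnSet_eq c
  · rw [ColSet.Target.maj_eq]
    refine (hφ F).sum_rowMaj_eq ?_
    rw [F.1.basement, F.1.basement]
    exact Nat.add_lt_add_right hσ 1
  · obtain ⟨F, hF⟩ := ColSet.exists_preimage hij hα h G
    refine ⟨F, ColSet.Target.entry_injective hne (funext fun r => ?_)⟩
    obtain ⟨hi, hj⟩ := (hφ F).rows.right_unique hF.rows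
    by_cases hri : r = i
    · rw [hri, hi]
    by_cases hrj : r = j
    · rw [hrj, hj]
    rw [(hφ F).other r hri hrj, hF.other r hri hrj]
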